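/- **Setting.** Let $n\ge 1$ and $k=\lceil\log_2 n\rceil$. The SOS2 constraint $\mathcal P=(P^i)_{i=1}^n$ on the simplex $\Delta^{n+1}=\{\lambda\in\mathbb R^{n+1}_+ : \sum_{j=1}^{n+1}\lambda_j=1\}$ is the family $P^i=\{\lambda\in\Delta^{n+1} : \lambda_j\le 0\ \ \forall j\notin\{i,i+1\}\}$. A Gray code is a family $H=(h^i)_{i=1}^n$ of pairwise distinct vectors $h^i\in\{0,1\}^k$ with $\sum_{l=1}^k|h^i_l-h^{i+1}_l|=1$ for all $i\in\{1,\dots,n-1\}$. Put $Q(\mathcal P,H)=\operatorname{conv}\bigl(\bigcup_{i=1}^n P^i\times\{h^i\}\bigr)\subseteq\mathbb R^{n+1}\times\mathbb R^k$, $h^0=h^1$, $h^{n+1}=h^n$, $c^i=h^{i+1}-h^i$ for $1\le i\le n-1$, and $L(H)=\operatorname{aff}(H)-h^1$, $\dim(H)=\dim L(H)$. For a polyhedron $Q$ let $\operatorname{size}(Q)$ be the minimum number of linear inequalities needed to describe $Q$ (an equation counts as two inequalities). Let $\operatorname{size}_G(Q(\mathcal P,H))$ be twice the number of linear hyperplanes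 of $L(H)$ that are spanned by subfamilies of $(c^i)_{i=1}^{n-1}$, and let $\operatorname{size}_B(Q(\mathcal P,H))=|J|$, where $J=\{1,n+1\}\cup\{j\in\{2,\dots,n\} : L(H)=\operatorname{span}\{c^i : 1\le i\le n-1,\ i\ne j-1\}\}$. **Corollary.** Let $H$ be a Gray code. Then $(\lambda,y)\in Q(\mathcal P,H)$ if and only if $$\sum_{j=1}^{n+1}\lambda_j=1,\tag{1}$$ $$\sum_{j=1}^{n+1}\min\{h^j_l,h^{j-1}_l\}\lambda_j\ \le\ y_l\ \le\ \sum_{j=1}^{n+1}\max\{h^j_l,h^{j-1}_l\}\lambda_j\qquad\forall l\in\{1,\dots,k\},\tag{2}$$ $$\lambda_j\ge 0\qquad\forall j\in\{1,\dots,n+1\}.\tag{3}$$ Furthermore, all inequalities in (2) are facet defining for $Q(\mathcal P,H)$, and $\operatorname{size}_G(Q(\mathcal P,H))=2\lceil\log_2 n\rceil$. In addition, at least $n-1$ of the inequalities in (3) are facet defining, $\operatorname{size}_B(Q(\mathcal P,H))$ is the number of inequalities in (3) that are facet defining, $\operatorname{size}(Q(\mathcal P,H))=\operatorname{size}_G(Q(\mathcal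 P,H))+\operatorname{size}_B(Q(\mathcal P,H))+2(1+k-\dim(H))$, and $$\bigl|\operatorname{size}_B(Q(\mathcal P,H))-n\bigr|\le 1,\qquad \bigl|\operatorname{size}(Q(\mathcal P,H))-(2\lceil\log_2 n\rceil+n+2)\bigr|\le 1.$$ Finally, these last two bounds are tight: there are some $n\ge 2$ and a Gray code $H$ for which both differences inside the absolute values equal $1$, and some $n\ge 2$ and a Gray code $H$ for which both equal $-1$. -/

import Mathlib

open scoped BigOperators

noncomputable section

namespace EmbeddingForm

/-- The embedding `Q(P, H)`: the convex hull of the union of the sets `Pⁱ × {hⁱ}`. -/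
def embedding {ι E F : Type*} [AddCommGroup E] [Module ℝ E] [AddCommGroup F] [Module ℝ F]
    (P : ι → Set E) (h : ι → F) : Set (E × F) :=
  convexHull ℝ (⋃ i, P i ×ˢ {h i})

/-- The SOS2 constraint on the standard simplex of `ℝⁿ⁺¹`: the `i`-th polyhedron consists of the
points of the simplex whose coordinates vanish outside the two adjacent positions `i`, `i + 1`. -/
def sos2 (n : ℕ) (i : Fin n) : Set (Fin (n + 1) → ℝ) :=
  {lam | lam ∈ stdSimplex ℝ (Fin (n + 1)) ∧ ∀ j, j ≠ i.castSucc → j ≠ i.succ → lam j ≤ 0}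

/-- An encoding: a family of `n` pairwise distinct `0`-`1` vectors with `k` components. -/
def IsEncoding {n k : ℕ} (h : Fin n → Fin k → ℝ) : Prop :=
  (∀ i l, h i l = 0 ∨ h i l = 1) ∧ Function.Injective h

/-- A Gray code: an encoding with `⌈log₂ n⌉` bits in which exactly one bit changes between
consecutive vectors. -/
def IsGrayCode {n : ℕ} (h : Fin n → Fin (Nat.clog 2 n) → ℝ) : Prop :=
  IsEncoding h ∧
    ∀ (i : ℕ) (hi : i + 1 < n), ∑ l, |h ⟨i, by omega⟩ l - h ⟨i + 1, hi⟩ l| = 1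

/-- The vector `hᵐ` in the usual numbering `h¹, …, hⁿ` (the entry `h ⟨m - 1, _⟩` of the
zero-based family), extended by `h⁰ = h¹` and `hⁿ⁺¹ = hⁿ`. -/
def code {α : Type*} {n : ℕ} (hn : 0 < n) (h : Fin n → α) (m : ℕ) : α :=
  h ⟨min (m - 1) (n - 1), by omega⟩

/-- The difference `cⁱ = hⁱ⁺¹ - hⁱ`. -/
def step {n k : ℕ} (hn : 0 < n) (h : Fin n → Fin k → ℝ) (i : ℕ) : Fin k → ℝ :=
  code hn h (i + 1) - code hn h i

/-- `L(H)`: the linear space parallel to the affine hull of the encoding. -/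
def encSpace {n k : ℕ} (h : Fin n → Fin k → ℝ) : Submodule ℝ (Fin k → ℝ) :=
  vectorSpan ℝ (Set.range h)

/-- The linear hyperplanes of `L(H)` that are spanned by subfamilies of `c¹, …, cⁿ⁻¹`. -/
def spannedHyperplanes {n k : ℕ} (hn : 0 < n) (h : Fin n → Fin k → ℝ) :
    Set (Submodule ℝ (Fin k → ℝ)) :=
  {W | W ≤ encSpace h ∧ Module.finrank ℝ W + 1 = Module.finrank ℝ (encSpace h) ∧
    ∃ I : Set ℕ, I ⊆ Set.Icc 1 (n - 1) ∧ W = Submodule.span ℝ (step hn h '' I)}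

/-- The set `J ⊆ {1, …, n + 1}`: the two ends, and those `j ∈ {2, …, n}` for which the differences
other than `cʲ⁻¹` still span `L(H)`. -/
def boundIndices {n k : ℕ} (hn : 0 < n) (h : Fin n → Fin k → ℝ) : Set ℕ :=
  {1, n + 1} ∪
    {j | j ∈ Set.Icc 2 n ∧
      encSpace h = Submodule.span ℝ (step hn h '' (Set.Icc 1 (n - 1) \ {j - 1}))}

/-- `size_G`: the number of general inequalities, two for each hyperplane of `L(H)` spanned by the
differences. -/
def sizeG {n k : ℕ} (hn : 0 < n) (h : Fin n → Fin k → ℝ) : ℕ :=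
  2 * (spannedHyperplanes hn h).ncard

/-- `size_B`: the number of variable bounds `0 ≤ λ_j`, `j ∈ J`. -/
def sizeB {n k : ℕ} (hn : 0 < n) (h : Fin n → Fin k → ℝ) : ℕ :=
  (boundIndices hn h).ncard

/-- The size of a polyhedron: the least number of linear inequalities that describe it. An equation
has to be written as two inequalities. -/
def polySize {V : Type*} [AddCommGroup V] [Module ℝ V] (Q : Set V) : ℕ :=
  sInf {m : ℕ | ∃ (a : Fin m → Module.Dual ℝ V) (β : Fin m → ℝ), Q = {x | ∀ i, a i x ≤ β i}}

/-- A facet: a nonempty exposed face whose dimension is one less than that of `Q`. -/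
def IsFacet {V : Type*} [AddCommGroup V] [Module ℝ V] [TopologicalSpace V] (Q F : Set V) : Prop :=
  IsExposed ℝ Q F ∧ F.Nonempty ∧
    Module.finrank ℝ (vectorSpan ℝ F) + 1 = Module.finrank ℝ (vectorSpan ℝ Q)

/-- The inequality `f x ≤ g x` is facet defining for `Q`: it is valid on `Q` and it holds with
equality exactly on a facet. -/
def FacetDefining {V : Type*} [AddCommGroup V] [Module ℝ V] [TopologicalSpace V] (Q : Set V)
    (f g : V → ℝ) : Prop :=
  (∀ x ∈ Q, f x ≤ g x) ∧ IsFacet Q {x | x ∈ Q ∧ f x = g x}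

end EmbeddingForm

end

open EmbeddingForm

/-!
Each step of a Gray code is a signed unit vector. Hence, over the `j`-th vertex of the simplex, the
box described by the general inequalities is the segment between `hʲ⁻¹` and `hʲ`, and the polytope
described by all the inequalities is the convex hull of these segments, which is `Q(P, H)`.

If the `l`-th bit is flipped at a single position `j`, then its two inequalities differ by
a multiple of `0 ≤ λ_j`, so this bound is redundant and its face lies in two facets. The other
inequalities form an irredundant system in the hyperplane `∑ j, λ_j = 1`, so they are exactly the
facets, and the size is their number plus the two inequalities of the equation.

If `s` bits are flipped only once, then they take at most `s + 1` joint values along the code, so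
`n ≤ (s + 1) * 2 ^ (k - s)`. As `2 ^ (k - 1) < n`, this forces `s ≤ 2`, and `s = 0` and `s = 2`
both occur.
-/

open scoped Topology

namespace EmbeddingForm

section ConeSlice

variable {V ι : Type*} [AddCommGroup V] [Module ℝ V]

/-- The polyhedron cut out of the hyperplane `s x = 1` by the inequalities `0 ≤ g i x`. Linear forms
suffice, because every affine function agrees with a linear form on this hyperplane. -/
def coneSlice (s : Module.Dual ℝ V) (g : ι → Module.Dual ℝ V) : Set V :=
  {x | s x = 1 ∧ ∀ i, 0 ≤ g i x}

/-- The system `s x = 1`, `0 ≤ g i x` is irredundant: some point satisfies all inequalities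
strictly, and for each `i` some point satisfies the `i`-th inequality with equality and all others
strictly. -/
structure Irredundant (s : Module.Dual ℝ V) (g : ι → Module.Dual ℝ V) : Prop where
  exists_strict : ∃ x, s x = 1 ∧ ∀ i, 0 < g i x
  exists_tight : ∀ i, ∃ x, s x = 1 ∧ g i x = 0 ∧ ∀ j ≠ i, 0 < g j x

variable {s : Module.Dual ℝ V} {g : ι → Module.Dual ℝ V} {x v z : V} {i : ι}

lemma exists_smul_eq_one_and_pos_iff (hx : 0 < s x) :
    ∃ y, s y = 1 ∧ ∀ i, (0 < g i y ↔ 0 < g i x) ∧ (g i y = 0 ↔ g i x = 0) :=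
  ⟨(s x)⁻¹ • x, by simp [hx.ne'], fun i => by simp [hx, hx.ne']⟩

lemma Irredundant.of_pos (h : ∃ x, 0 < s x ∧ ∀ i, 0 < g i x)
    (h' : ∀ i, ∃ x, 0 < s x ∧ g i x = 0 ∧ ∀ j ≠ i, 0 < g j x) : Irredundant s g where
  exists_strict := by
    obtain ⟨x, hx, hgx⟩ := h
    obtain ⟨y, hy, hgy⟩ := exists_smul_eq_one_and_pos_iff (g := g) hx
    exact ⟨y, hy, fun i => (hgy i).1.2 (hgx i)⟩
  exists_tight i := by
    obtain ⟨x, hx, hix, hgx⟩ := h' i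
    obtain ⟨y, hy, hgy⟩ := exists_smul_eq_one_and_pos_iff (g := g) hx
    exact ⟨y, hy, (hgy i).2.2 hix, fun j hj => (hgy j).1.2 (hgx j hj)⟩

lemma convex_coneSlice : Convex ℝ (coneSlice s g) := by
  intro x hx y hy a b ha hb hab
  refine ⟨by simp [hx.1, hy.1, hab], fun i => ?_⟩
  simpa using add_nonneg (mul_nonneg ha (hx.2 i)) (mul_nonneg hb (hy.2 i))

lemma mem_coneSlice_of_tight (hx : s x = 1) (hi : g i x = 0) (hg : ∀ j ≠ i, 0 < g j x) :
    x ∈ coneSlice s g := by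
  refine ⟨hx, fun j => ?_⟩
  rcases eq_or_ne j i with rfl | hj
  exacts [hi.ge, (hg j hj).le]

lemma exists_pos_forall_add_mul_nonneg [Finite ι] {p q : ι → ℝ}
    (h : ∀ i, 0 < p i ∨ (0 ≤ p i ∧ 0 ≤ q i)) : ∃ ε > 0, ∀ i, 0 ≤ p i + ε * q i := by
  have eventually_nonneg : ∀ᶠ ε in 𝓝[>] (0 : ℝ), ∀ i, 0 ≤ p i + ε * q i := by
    refine Filter.eventually_all.2 fun i => ?_
    rcases h i with hp | ⟨hp, hq⟩
    · have hc : ContinuousAt (fun ε : ℝ => p i + ε * q i) 0 := by fun_prop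
      have hpos : ∀ᶠ ε in 𝓝 (0 : ℝ), 0 < p i + ε * q i :=
        hc.eventually (lt_mem_nhds (by simpa using hp))
      exact (hpos.filter_mono nhdsWithin_le_nhds).mono fun _ => le_of_lt
    · filter_upwards [self_mem_nhdsWithin] with ε hε
      exact add_nonneg hp (mul_nonneg (le_of_lt hε) hq)
  obtain ⟨ε, hnonneg, hε⟩ := (eventually_nonneg.and self_mem_nhdsWithin).exists
  exact ⟨ε, hε, hnonneg⟩

lemma exists_pos_add_smul_mem_coneSlice [Finite ι] (hx : x ∈ coneSlice s g) (hv : s v = 0)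
    (h : ∀ i, 0 < g i x ∨ 0 ≤ g i v) : ∃ ε > (0 : ℝ), x + ε • v ∈ coneSlice s g := by
  obtain ⟨ε, hε, hg⟩ := exists_pos_forall_add_mul_nonneg fun i =>
    (h i).imp_right fun hi => And.intro (hx.2 i) hi
  exact ⟨ε, hε, by simp [hv, hx.1], fun i => by simpa using hg i⟩

section Facets

lemma mem_vectorSpan_of_add_smul_mem {S : Set V} {ε : ℝ} (hε : 0 < ε) (hx : x ∈ S)
    (h : x + ε • v ∈ S) : v ∈ vectorSpan ℝ S := by
  simpa [smul_smul, hε.ne'] using Submodule.smul_mem _ ε⁻¹ (vsub_mem_vectorSpan ℝ h hx)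

lemma vectorSpan_le_ker {S : Set V} {f : Module.Dual ℝ V} {c : ℝ} (h : ∀ x ∈ S, f x = c) :
    vectorSpan ℝ S ≤ LinearMap.ker f := by
  refine Submodule.span_le.2 ?_
  rintro _ ⟨x, hx, y, hy, rfl⟩
  simp [h x hx, h y hy]

lemma Irredundant.vectorSpan_coneSlice [Finite ι] (H : Irredundant s g) :
    vectorSpan ℝ (coneSlice s g) = LinearMap.ker s := by
  refine le_antisymm (vectorSpan_le_ker fun x hx => hx.1) fun v hv => ?_
  obtain ⟨x, hx, hg⟩ := H.exists_strict
  have hxQ : x ∈ coneSlice s g := ⟨hx, fun i => (hg i).le⟩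
  obtain ⟨ε, hε, h⟩ := exists_pos_add_smul_mem_coneSlice hxQ hv fun i => Or.inl (hg i)
  exact mem_vectorSpan_of_add_smul_mem hε hxQ h

lemma Irredundant.vectorSpan_face [Finite ι] (H : Irredundant s g) (i : ι) :
    vectorSpan ℝ {x | x ∈ coneSlice s g ∧ g i x = 0} = LinearMap.ker s ⊓ LinearMap.ker (g i) := by
  refine le_antisymm (le_inf (vectorSpan_le_ker fun x hx => hx.1.1)
    (vectorSpan_le_ker fun x hx => hx.2)) ?_
  rintro v ⟨hsv, hiv : g i v = 0⟩
  obtain ⟨x, hx, hi, hg⟩ := H.exists_tight i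
  have hxQ := mem_coneSlice_of_tight hx hi hg
  obtain ⟨ε, hε, h⟩ := exists_pos_add_smul_mem_coneSlice hxQ hsv fun j => by
    rcases eq_or_ne j i with rfl | hj
    exacts [Or.inr hiv.ge, Or.inl (hg j hj)]
  exact mem_vectorSpan_of_add_smul_mem hε ⟨hxQ, hi⟩ ⟨h, by simp [hi, hiv]⟩

lemma finrank_inf_ker_add_one [FiniteDimensional ℝ V] {S : Submodule ℝ V} {f : Module.Dual ℝ V}
    (hv : v ∈ S) (hf : f v ≠ 0) :
    Module.finrank ℝ ↥(S ⊓ LinearMap.ker f) + 1 = Module.finrank ℝ S := by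
  have hne : f.domRestrict S ≠ 0 := fun h => hf (LinearMap.congr_fun h ⟨v, hv⟩)
  rw [← Module.Dual.finrank_ker_add_one_of_ne_zero hne, LinearMap.ker_domRestrict,
    ← Submodule.finrank_map_subtype_eq, Submodule.map_comap_subtype]

variable [TopologicalSpace V] [FiniteDimensional ℝ V]

lemma isExposed_setOf_eq_zero [IsTopologicalAddGroup V] [ContinuousSMul ℝ V] [T2Space V]
    {Q : Set V} {f : Module.Dual ℝ V} (hf : ∀ x ∈ Q, 0 ≤ f x) :
    IsExposed ℝ Q {x | x ∈ Q ∧ f x = 0} := by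
  rintro ⟨z, hz, hfz⟩
  refine ⟨LinearMap.toContinuousLinearMap (-f), ?_⟩
  ext x
  simp only [Set.mem_ofPred_eq, LinearMap.coe_toContinuousLinearMap', LinearMap.neg_apply,
    neg_le_neg_iff]
  refine and_congr_right fun hx => ⟨fun h y hy => h ▸ hf y hy, fun h => ?_⟩
  exact le_antisymm (hfz ▸ h z hz) (hf x hx)

lemma Irredundant.isFacet [IsTopologicalAddGroup V] [ContinuousSMul ℝ V] [T2Space V] [Finite ι]
    (H : Irredundant s g) (i : ι) :
    IsFacet (coneSlice s g) {x | x ∈ coneSlice s g ∧ g i x = 0} := by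
  obtain ⟨x, hx, hi, hg⟩ := H.exists_tight i
  obtain ⟨z, hz, hgz⟩ := H.exists_strict
  refine ⟨isExposed_setOf_eq_zero fun x hx => hx.2 i, ⟨x, mem_coneSlice_of_tight hx hi hg, hi⟩, ?_⟩
  rw [H.vectorSpan_face, H.vectorSpan_coneSlice]
  exact finrank_inf_ker_add_one (v := z - x) (by simp [hx, hz]) (by simpa [hi] using (hgz i).ne')

lemma Irredundant.facetDefining [IsTopologicalAddGroup V] [ContinuousSMul ℝ V] [T2Space V]
    [Finite ι] (H : Irredundant s g) (i : ι) {f₁ f₂ : V → ℝ} (hf : ∀ x, g i x = f₂ x - f₁ x) :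
    FacetDefining (coneSlice s g) f₁ f₂ := by
  refine ⟨fun x hx => sub_nonneg.1 (hf x ▸ hx.2 i), ?_⟩
  have hface : {x | x ∈ coneSlice s g ∧ f₁ x = f₂ x} = {x | x ∈ coneSlice s g ∧ g i x = 0} := by
    simp only [hf, sub_eq_zero, eq_comm]
  exact hface ▸ H.isFacet i

lemma Irredundant.not_isFacet [Finite ι] (H : Irredundant s g) {i' : ι} (hne : i ≠ i') {F : Set V}
    (hF : ∀ x ∈ F, x ∈ coneSlice s g ∧ g i x = 0 ∧ g i' x = 0) : ¬ IsFacet (coneSlice s g) F := by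
  rintro ⟨-, ⟨p, hp⟩, hdim⟩
  obtain ⟨x, hx, hi, hg⟩ := H.exists_tight i
  obtain ⟨z, hz, hgz⟩ := H.exists_strict
  obtain ⟨hpQ, hip, hip'⟩ := hF p hp
  have codim_one := finrank_inf_ker_add_one (S := LinearMap.ker s) (f := g i) (v := z - x)
    (by simp [hx, hz]) (by simpa [hi] using (hgz i).ne')
  have codim_two := finrank_inf_ker_add_one (S := LinearMap.ker s ⊓ LinearMap.ker (g i))
    (f := g i') (v := x - p) (by simp [hx, hpQ.1, hi, hip])
    (by simpa [hip'] using (hg i' hne.symm).ne')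
  have hle : vectorSpan ℝ F ≤ LinearMap.ker s ⊓ LinearMap.ker (g i) ⊓ LinearMap.ker (g i') :=
    le_inf (le_inf (vectorSpan_le_ker fun x hx => (hF x hx).1.1)
      (vectorSpan_le_ker fun x hx => (hF x hx).2.1)) (vectorSpan_le_ker fun x hx => (hF x hx).2.2)
  have dim_le := Submodule.finrank_mono hle
  rw [H.vectorSpan_coneSlice] at hdim
  omega

end Facets

section Size

lemma exists_rows_coneSlice [Fintype ι] :
    ∃ (a : Fin (Fintype.card ι + 2) → Module.Dual ℝ V) (β : Fin (Fintype.card ι + 2) → ℝ),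
      coneSlice s g = {x | ∀ r, a r x ≤ β r} := by
  obtain ⟨e⟩ : Nonempty (Fin (Fintype.card ι + 2) ≃ ι ⊕ Bool) :=
    ⟨(Fintype.equivFinOfCardEq (by simp)).symm⟩
  have hrows : coneSlice s g = {x | ∀ r, Sum.elim (fun i => -g i) (fun b => cond b s (-s)) r x ≤
      Sum.elim (fun _ => (0 : ℝ)) (fun b => cond b 1 (-1)) r} := by
    ext x
    simp [coneSlice, le_antisymm_iff, and_comm]
  refine ⟨_ ∘ e, _ ∘ e, hrows.trans (Set.ext fun x => e.surjective.forall)⟩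

variable {κ : Type*} {a : κ → Module.Dual ℝ V} {β : κ → ℝ}

lemma exists_tight_row_of_forall_notMem [Finite κ] (hx : ∀ r, a r x ≤ β r)
    (hv : ∀ ε > (0 : ℝ), ¬ ∀ r, a r (x + ε • v) ≤ β r) : ∃ r, a r x = β r ∧ 0 < a r v := by
  by_contra! hrow
  obtain ⟨ε, hε, hnonneg⟩ := exists_pos_forall_add_mul_nonneg (p := fun r => β r - a r x)
    (q := fun r => - a r v) fun r => (hx r).lt_or_eq.imp sub_pos.2 fun h =>
      ⟨sub_nonneg.2 h.le, neg_nonneg.2 (hrow r h)⟩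
  refine hv ε hε fun r => ?_
  have := hnonneg r
  simp only [map_add, map_smul, smul_eq_mul]
  linarith

lemma eq_of_forall_le_of_eq_strict [Finite ι] {f : Module.Dual ℝ V} {c : ℝ}
    (hf : ∀ y ∈ coneSlice s g, f y ≤ c) (hz : s z = 1) (hg : ∀ i, 0 < g i z) (hfz : f z = c)
    (hx : x ∈ coneSlice s g) : f x = c := by
  have hzQ : z ∈ coneSlice s g := ⟨hz, fun i => (hg i).le⟩
  obtain ⟨ε, hε, hmem⟩ := exists_pos_add_smul_mem_coneSlice (v := z - x) hzQ (by simp [hz, hx.1])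
    fun i => Or.inl (hg i)
  have hle := hf _ hmem
  simp only [map_add, map_smul, map_sub, smul_eq_mul, hfz] at hle
  exact (hf x hx).antisymm (by nlinarith)

variable [Fintype κ]

-- A row tight at the tight points of two different inequalities would be tight at their midpoint,
-- which satisfies all inequalities strictly.
lemma Irredundant.card_le_card_slack_rows [Fintype ι] (H : Irredundant s g)
    (hQ : coneSlice s g = {x | ∀ r, a r x ≤ β r}) (hz : s z = 1) (hgz : ∀ i, 0 < g i z) :
    Fintype.card ι ≤ Fintype.card {r // a r z < β r} := by
  have hzQ : z ∈ coneSlice s g := ⟨hz, fun i => (hgz i).le⟩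
  have hle : ∀ r, ∀ x ∈ coneSlice s g, a r x ≤ β r := fun r x hx => hQ.le hx r
  choose p hsp hip hgp using H.exists_tight
  have hpQ : ∀ i, p i ∈ coneSlice s g := fun i => mem_coneSlice_of_tight (hsp i) (hip i) (hgp i)
  have exists_row : ∀ i, ∃ r, a r (p i) = β r ∧ 0 < a r (p i - z) := fun i => by
    refine exists_tight_row_of_forall_notMem (fun r => hle r _ (hpQ i)) fun ε hε hmem => ?_
    have hnonneg := (hQ.ge hmem).2 i
    simp only [map_add, map_smul, smul_eq_mul, map_sub, hip] at hnonneg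
    nlinarith [mul_pos hε (hgz i)]
  choose r hr hrz using exists_row
  have hslack : ∀ i, a (r i) z < β (r i) := fun i => by simpa [hr] using hrz i
  refine Fintype.card_le_of_injective (fun i => ⟨r i, hslack i⟩) fun i i' hii => ?_
  obtain hrow : r i = r i' := congrArg Subtype.val hii
  by_contra hne
  have midpoint_pos : ∀ j, 0 < g j (midpoint ℝ (p i) (p i')) := fun j => by
    rw [midpoint_eq_smul_add, map_smul, map_add]
    refine smul_pos (by norm_num) ?_
    rcases eq_or_ne j i with rfl | hj
    · exact add_pos_of_nonneg_of_pos ((hpQ j).2 j) (hgp i' j hne)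
    · exact add_pos_of_pos_of_nonneg (hgp i j hj) ((hpQ i').2 j)
  have midpoint_tight : a (r i) (midpoint ℝ (p i) (p i')) = β (r i) := by
    have hr' := hr i'
    rw [← hrow] at hr'
    simp only [midpoint_eq_smul_add, map_smul, map_add, hr, hr', smul_eq_mul, invOf_eq_inv]
    ring
  exact (hslack i).ne (eq_of_forall_le_of_eq_strict (hle _)
    (by simp [midpoint_eq_smul_add, hsp]; norm_num) midpoint_pos midpoint_tight hzQ)

-- The directions `z` and `-z` leave the hyperplane `s x = 1`.
lemma two_le_card_tight_rows (hQ : coneSlice s g = {x | ∀ r, a r x ≤ β r})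
    (hz : z ∈ coneSlice s g) : 2 ≤ Fintype.card {r // ¬ a r z < β r} := by
  have hle : ∀ r, a r z ≤ β r := hQ.le hz
  have exists_row : ∀ c : ℝ, c ≠ 0 → ∃ r, a r z = β r ∧ 0 < a r (c • z) := fun c hc =>
    exists_tight_row_of_forall_notMem hle fun ε hε hmem => by
      have hs := (hQ.ge hmem).1
      simp [hz.1, hε.ne', hc] at hs
  obtain ⟨u, hu, hu_pos⟩ := exists_row 1 one_ne_zero
  obtain ⟨w, hw, hw_pos⟩ := exists_row (-1) (by norm_num)
  refine Fintype.one_lt_card_iff.2 ⟨⟨u, hu.not_lt⟩, ⟨w, hw.not_lt⟩, fun h => ?_⟩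
  obtain rfl : u = w := congrArg Subtype.val h
  simp only [map_smul, smul_eq_mul] at hu_pos hw_pos
  linarith

lemma Irredundant.card_add_two_le [Fintype ι] (H : Irredundant s g)
    (hQ : coneSlice s g = {x | ∀ r, a r x ≤ β r}) : Fintype.card ι + 2 ≤ Fintype.card κ := by
  obtain ⟨z, hz, hgz⟩ := H.exists_strict
  calc Fintype.card ι + 2
      ≤ Fintype.card {r // a r z < β r} + Fintype.card {r // ¬ a r z < β r} :=
        add_le_add (H.card_le_card_slack_rows hQ hz hgz)
          (two_le_card_tight_rows hQ ⟨hz, fun i => (hgz i).le⟩)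
    _ = Fintype.card κ := by
        rw [Fintype.card_subtype_compl, Nat.add_sub_of_le (Fintype.card_subtype_le _)]

lemma Irredundant.polySize_coneSlice [Fintype ι] (H : Irredundant s g) :
    polySize (coneSlice s g) = Fintype.card ι + 2 := by
  refine IsLeast.csInf_eq ⟨exists_rows_coneSlice, ?_⟩
  rintro m ⟨a, β, hQ⟩
  simpa using H.card_add_two_le hQ

end Size

end ConeSlice

section SimplexBand

variable {J L : Type*}

/-- The elements `j` for which `{j}` is a member of the family `F`. -/
def soleElements (F : L → Set J) : Set J := {j | ∃ l, F l = {j}}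

/-- The columns in which the `l`-th rows of `a` and `b` differ. -/
def gaps (a b : L → J → ℝ) (l : L) : Set J := {j | a l j ≠ b l j}

/-- The linear form `(λ, y) ↦ λ j`. -/
def coordForm (j : J) : Module.Dual ℝ ((J → ℝ) × (L → ℝ)) :=
  LinearMap.proj j ∘ₗ LinearMap.fst ℝ _ _

@[simp]
lemma coordForm_apply {p : (J → ℝ) × (L → ℝ)} {j : J} : coordForm j p = p.1 j := rfl

variable [Fintype J]

/-- The polytope of all pairs of a point `λ` of the simplex and a vector whose entries lie between
those of `a λ` and `b λ`. -/
def simplexBand (a b : L → J → ℝ) : Set ((J → ℝ) × (L → ℝ)) :=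
  {p | ∑ j, p.1 j = 1 ∧ (∀ l, ∑ j, a l j * p.1 j ≤ p.2 l ∧ p.2 l ≤ ∑ j, b l j * p.1 j) ∧
    ∀ j, 0 ≤ p.1 j}

/-- The width of the interval that `simplexBand a b` allows for the `l`-th entry over `w`. -/
def bandWidth (a b : L → J → ℝ) (w : J → ℝ) (l : L) : ℝ := ∑ j, (b l j - a l j) * w j

/-- The point over `w` whose `l`-th entry divides the allowed interval in the ratio
`θ l : 1 - θ l`. -/
def bandPoint (a b : L → J → ℝ) (θ : L → ℝ) (w : J → ℝ) : (J → ℝ) × (L → ℝ) :=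
  (w, fun l => ∑ j, a l j * w j + θ l * bandWidth a b w l)

/-- The linear form `(λ, y) ↦ ∑ j, λ j`. -/
def sumForm : Module.Dual ℝ ((J → ℝ) × (L → ℝ)) := ∑ j, coordForm j

/-- The excess of the entry `y l` over its lower bound. -/
def lowerForm (a : L → J → ℝ) (l : L) : Module.Dual ℝ ((J → ℝ) × (L → ℝ)) :=
  LinearMap.proj l ∘ₗ LinearMap.snd ℝ _ _ - ∑ j, a l j • coordForm j

/-- The gap between the entry `y l` and its upper bound. -/
def upperForm (b : L → J → ℝ) (l : L) : Module.Dual ℝ ((J → ℝ) × (L → ℝ)) :=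
  ∑ j, b l j • coordForm j - LinearMap.proj l ∘ₗ LinearMap.snd ℝ _ _

/-- The linear forms of the inequalities of `simplexBand a b`, without the bounds `0 ≤ λ j` that
follow from a pair of general inequalities. -/
def facetForm (a b : L → J → ℝ) :
    L ⊕ L ⊕ ↥(soleElements (gaps a b))ᶜ → Module.Dual ℝ ((J → ℝ) × (L → ℝ)) :=
  Sum.elim (lowerForm a) (Sum.elim (upperForm b) fun j => coordForm (j : J))

variable {a b : L → J → ℝ} {θ : L → ℝ} {w : J → ℝ} {p : (J → ℝ) × (L → ℝ)} {j : J} {l : L}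

@[simp]
lemma sumForm_apply : sumForm p = ∑ j, p.1 j := by simp [sumForm]

@[simp]
lemma lowerForm_apply : lowerForm a l p = p.2 l - ∑ j, a l j * p.1 j := by simp [lowerForm]

@[simp]
lemma upperForm_apply : upperForm b l p = ∑ j, b l j * p.1 j - p.2 l := by simp [upperForm]

lemma bandWidth_eq_sub :
    bandWidth a b w l = ∑ j, b l j * w j - ∑ j, a l j * w j := by
  simp only [bandWidth, sub_mul, Finset.sum_sub_distrib]

lemma lowerForm_bandPoint : lowerForm a l (bandPoint a b θ w) = θ l * bandWidth a b w l := by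
  simp [bandPoint]

lemma upperForm_bandPoint : upperForm b l (bandPoint a b θ w) = (1 - θ l) * bandWidth a b w l := by
  rw [upperForm_apply, sub_mul, one_mul, bandWidth_eq_sub]
  simp only [bandPoint, bandWidth_eq_sub]
  ring

lemma bandWidth_of_gaps_eq_singleton (h : gaps a b l = {j}) :
    bandWidth a b w l = (b l j - a l j) * w j := by
  refine Finset.sum_eq_single j (fun i _ hi => ?_) (by simp)
  have heq : a l i = b l i := by simpa [gaps] using (h.symm ▸ hi : i ∉ gaps a b l)
  rw [heq, sub_self, zero_mul]

lemma bandWidth_pos (hab : a ≤ b) (hw : 0 ≤ w) (hj : j ∈ gaps a b l) (hwj : 0 < w j) :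
    0 < bandWidth a b w l :=
  Finset.sum_pos' (fun i _ => mul_nonneg (sub_nonneg.2 (hab l i)) (hw i))
    ⟨j, Finset.mem_univ j, mul_pos (sub_pos.2 ((hab l j).lt_of_ne hj)) hwj⟩

lemma simplexBand_eq_coneSlice (hab : a ≤ b) :
    simplexBand a b = coneSlice sumForm (facetForm a b) := by
  ext p
  simp only [simplexBand, coneSlice, facetForm, Set.mem_ofPred_eq, Sum.forall, Sum.elim_inl,
    Sum.elim_inr, sumForm_apply, lowerForm_apply, upperForm_apply, coordForm_apply, sub_nonneg,
    Subtype.forall, forall_and, and_assoc]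
  refine and_congr_right fun _ => and_congr_right fun hl => and_congr_right fun hu =>
    ⟨fun h j _ => h j, fun h j => ?_⟩
  by_cases hj : j ∈ soleElements (gaps a b)
  · obtain ⟨l, hgap⟩ := hj
    have width_nonneg : 0 ≤ (b l j - a l j) * p.1 j := by
      rw [← bandWidth_of_gaps_eq_singleton hgap, bandWidth_eq_sub, sub_nonneg]
      exact (hl l).trans (hu l)
    have hlt : a l j < b l j := (hab l j).lt_of_ne (hgap.ge rfl)
    exact nonneg_of_mul_nonneg_right width_nonneg (sub_pos.2 hlt)
  · exact h j hj

lemma exists_eq_bandPoint (hp : p ∈ simplexBand a b) :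
    ∃ θ : L → ℝ, (∀ l, θ l ∈ Set.Icc (0 : ℝ) 1) ∧ p = bandPoint a b θ p.1 := by
  have lower_nonneg (l) : 0 ≤ lowerForm a l p := by simpa using (hp.2.1 l).1
  have lower_le (l) : lowerForm a l p ≤ bandWidth a b p.1 l := by
    simpa [bandWidth_eq_sub] using (hp.2.1 l).2
  refine ⟨fun l => lowerForm a l p / bandWidth a b p.1 l, fun l =>
    ⟨div_nonneg (lower_nonneg l) ((lower_nonneg l).trans (lower_le l)),
      div_le_one_of_le₀ (lower_le l) ((lower_nonneg l).trans (lower_le l))⟩,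
    Prod.ext rfl (funext fun l => ?_)⟩
  have hzero (h : bandWidth a b p.1 l = 0) : lowerForm a l p = 0 :=
    ((lower_le l).trans_eq h).antisymm (lower_nonneg l)
  simp only [bandPoint]
  rw [div_mul_cancel_of_imp hzero, lowerForm_apply, add_sub_cancel]

lemma bandPoint_eq_sum [DecidableEq J] :
    bandPoint a b θ w =
      ∑ j, w j • ((Pi.single j 1, fun l => a l j + θ l * (b l j - a l j)) :
        (J → ℝ) × (L → ℝ)) := by
  refine Prod.ext ?_ (funext fun l => ?_)
  · simpa [bandPoint, Prod.fst_sum] using pi_eq_sum_univ' w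
  · simp only [bandPoint, bandWidth, Finset.mul_sum, ← Finset.sum_add_distrib, Prod.snd_sum,
      Finset.sum_apply, Prod.smul_mk, Pi.smul_apply, smul_eq_mul]
    exact Finset.sum_congr rfl fun j _ => by ring

lemma simplexBand_subset [DecidableEq J] (hab : a ≤ b) {C : Set ((J → ℝ) × (L → ℝ))}
    (hC : Convex ℝ C)
    (h : ∀ j y, (∀ l, y l ∈ Set.Icc (a l j) (b l j)) → (Pi.single j 1, y) ∈ C) :
    simplexBand a b ⊆ C := by
  intro p hp
  obtain ⟨θ, hθ, heq⟩ := exists_eq_bandPoint hp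
  rw [heq, bandPoint_eq_sum]
  refine hC.sum_mem (fun j _ => hp.2.2 j) hp.1 fun j _ => h j _ fun l => ⟨?_, ?_⟩
  · exact le_add_of_nonneg_right (mul_nonneg (hθ l).1 (sub_nonneg.2 (hab l j)))
  · nlinarith [mul_le_of_le_one_left (sub_nonneg.2 (hab l j)) (hθ l).2]

lemma facetForm_bandPoint_pos (hwidth : ∀ l, 0 < bandWidth a b w l)
    {i : L ⊕ L ⊕ ↥(soleElements (gaps a b))ᶜ}
    (h : Sum.elim (fun l => 0 < θ l) (Sum.elim (fun l => θ l < 1) fun j => 0 < w j.1) i) :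
    0 < facetForm a b i (bandPoint a b θ w) := by
  rcases i with l | l | j
  · exact lowerForm_bandPoint.trans_gt (mul_pos h (hwidth l))
  · exact upperForm_bandPoint.trans_gt (mul_pos (sub_pos.2 h) (hwidth l))
  · exact h

lemma exists_tight_coord [Nontrivial J] (hab : a ≤ b) (hgap : ∀ l, (gaps a b l).Nonempty)
    (hj : j ∉ soleElements (gaps a b)) :
    ∃ x, 0 < sumForm x ∧ coordForm j x = 0 ∧
      ∀ i ≠ Sum.inr (Sum.inr ⟨j, hj⟩), 0 < facetForm a b i x := by
  classical
  have weight_nonneg : (0 : J → ℝ) ≤ 1 - Pi.single j 1 := fun i => by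
    by_cases h : i = j <;> simp [h]
  have weight_pos {i} (hi : i ≠ j) : 0 < (1 - Pi.single j 1 : J → ℝ) i := by simp [hi]
  have width_pos (l) : 0 < bandWidth a b (1 - Pi.single j 1) l := by
    obtain ⟨i, hi, hij⟩ : ∃ i ∈ gaps a b l, i ≠ j := by
      by_contra! h
      exact hj ⟨l, Set.eq_singleton_iff_nonempty_unique_mem.2 ⟨hgap l, h⟩⟩
    exact bandWidth_pos hab weight_nonneg hi (weight_pos hij)
  obtain ⟨i, hij⟩ := exists_ne j
  refine ⟨bandPoint a b (fun _ => 1 / 2) (1 - Pi.single j 1), ?_, by simp [bandPoint],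
    fun i hi => facetForm_bandPoint_pos width_pos ?_⟩
  · rw [sumForm_apply]
    exact Finset.sum_pos' (fun i _ => weight_nonneg i) ⟨i, Finset.mem_univ i, weight_pos hij⟩
  · rcases i with l | l | ⟨i, _⟩
    · norm_num
    · norm_num
    · exact weight_pos fun h => hi (by simp [← h])

lemma irredundant_facetForm [Nontrivial J] (hab : a ≤ b) (hgap : ∀ l, (gaps a b l).Nonempty) :
    Irredundant sumForm (facetForm a b) := by
  classical
  have width_pos (l) : 0 < bandWidth a b 1 l :=
    bandWidth_pos hab zero_le_one (hgap l).some_mem one_pos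
  have sum_pos (θ) : 0 < sumForm (bandPoint a b θ 1) := by simp [bandPoint, Fintype.card_pos]
  refine .of_pos ⟨bandPoint a b (fun _ => 1 / 2) 1, sum_pos _, fun i => ?_⟩ ?_
  · exact facetForm_bandPoint_pos width_pos (by rcases i with l | l | j <;> norm_num)
  rintro (l | l | ⟨j, hj⟩)
  · refine ⟨bandPoint a b (Function.update (fun _ => 1 / 2) l 0) 1, sum_pos _,
      lowerForm_bandPoint.trans (by simp), fun i hi => facetForm_bandPoint_pos width_pos ?_⟩
    rcases i with l' | l' | j
    · have hne : l' ≠ l := by simpa using hi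
      simp [hne]
    · rcases eq_or_ne l' l with rfl | hne <;> norm_num [*]
    · exact one_pos
  · refine ⟨bandPoint a b (Function.update (fun _ => 1 / 2) l 1) 1, sum_pos _,
      upperForm_bandPoint.trans (by simp), fun i hi => facetForm_bandPoint_pos width_pos ?_⟩
    rcases i with l' | l' | j
    · rcases eq_or_ne l' l with rfl | hne <;> norm_num [*]
    · have hne : l' ≠ l := by simpa using hi
      norm_num [hne]
    · exact one_pos
  · exact exists_tight_coord hab hgap hj

lemma facetDefining_lower [Finite L] [Nontrivial J] (hab : a ≤ b)
    (hgap : ∀ l, (gaps a b l).Nonempty) (l : L) :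
    FacetDefining (simplexBand a b) (fun p => ∑ j, a l j * p.1 j) (fun p => p.2 l) := by
  rw [simplexBand_eq_coneSlice hab]
  exact (irredundant_facetForm hab hgap).facetDefining (Sum.inl l) fun p => lowerForm_apply

lemma facetDefining_upper [Finite L] [Nontrivial J] (hab : a ≤ b)
    (hgap : ∀ l, (gaps a b l).Nonempty) (l : L) :
    FacetDefining (simplexBand a b) (fun p => p.2 l) (fun p => ∑ j, b l j * p.1 j) := by
  rw [simplexBand_eq_coneSlice hab]
  exact (irredundant_facetForm hab hgap).facetDefining (Sum.inr (Sum.inl l))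
    fun p => upperForm_apply

-- If `{j}` is the `l`-th gap set, then the entry `y l` meets both of its bounds where `λ j = 0`, so
-- this face lies in two facets.
lemma facetDefining_coord_iff [Finite L] [Nontrivial J] (hab : a ≤ b)
    (hgap : ∀ l, (gaps a b l).Nonempty) :
    FacetDefining (simplexBand a b) (fun _ => 0) (fun p => p.1 j) ↔
      j ∉ soleElements (gaps a b) := by
  have H := irredundant_facetForm hab hgap
  rw [simplexBand_eq_coneSlice hab]
  refine ⟨?_, fun hj => H.facetDefining (Sum.inr (Sum.inr ⟨j, hj⟩)) fun p => by simp [facetForm]⟩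
  rintro ⟨-, hfacet⟩ ⟨l, hl⟩
  refine H.not_isFacet (i := Sum.inl l) (i' := Sum.inr (Sum.inl l)) (by simp) ?_ hfacet
  rintro p ⟨hp, hpj : 0 = p.1 j⟩
  have lower_nonneg : 0 ≤ lowerForm a l p := hp.2 (Sum.inl l)
  have upper_nonneg : 0 ≤ upperForm b l p := hp.2 (Sum.inr (Sum.inl l))
  have width_zero : bandWidth a b p.1 l = 0 := by
    rw [bandWidth_of_gaps_eq_singleton hl, ← hpj, mul_zero]
  have add_eq_width : lowerForm a l p + upperForm b l p = bandWidth a b p.1 l := by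
    rw [bandWidth_eq_sub, lowerForm_apply, upperForm_apply]
    ring
  exact ⟨hp, (add_eq_zero_iff_of_nonneg lower_nonneg upper_nonneg).1
    (add_eq_width.trans width_zero)⟩

lemma polySize_simplexBand [Fintype L] [Nontrivial J] (hab : a ≤ b)
    (hgap : ∀ l, (gaps a b l).Nonempty) :
    polySize (simplexBand a b) =
      2 * Fintype.card L + (soleElements (gaps a b))ᶜ.ncard + 2 := by
  classical
  rw [simplexBand_eq_coneSlice hab, (irredundant_facetForm hab hgap).polySize_coneSlice,
    Set.ncard_eq_toFinset_card', Set.toFinset_card, Fintype.card_sum, Fintype.card_sum]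
  ring

end SimplexBand

section Codes

variable {n k : ℕ} {hn : 0 < n} {h : Fin n → Fin k → ℝ}

/-- The positions, zero-based in `λ₁, …, λₙ₊₁`, at which the `l`-th bit changes: `j` stands for the
difference `cʲ`, where `c⁰ = cⁿ = 0`. -/
def flips (hn : 0 < n) (h : Fin n → Fin k → ℝ) (l : Fin k) : Set (Fin (n + 1)) :=
  {j | step hn h j l ≠ 0}

/-- A code each of whose steps changes at most one bit. -/
def IsRectilinear (hn : 0 < n) (h : Fin n → Fin k → ℝ) : Prop :=
  ∀ i l l', step hn h i l ≠ 0 → step hn h i l' ≠ 0 → l = l'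

lemma code_add_one (i : Fin n) : code hn h (i + 1) = h i :=
  congrArg h (Fin.ext (by simp; omega))

lemma mem_Icc_of_step_ne_zero {i : ℕ} (hi : step hn h i ≠ 0) : i ∈ Set.Icc 1 (n - 1) := by
  contrapose! hi
  refine sub_eq_zero.2 (congrArg h (Fin.ext ?_))
  rw [Set.mem_Icc] at hi
  simp only
  omega

lemma step_apply_ne_zero {i : ℕ} {l : Fin k} (hi : step hn h i l ≠ 0) : step hn h i ≠ 0 :=
  fun h0 => hi (congrFun h0 l)

lemma exists_mem_flips_of_step_ne_zero {i : ℕ} {l : Fin k} (hi : step hn h i l ≠ 0) :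
    ∃ j ∈ flips hn h l, (j : ℕ) = i := by
  have := mem_Icc_of_step_ne_zero (step_apply_ne_zero hi)
  exact ⟨⟨i, by grind⟩, hi, rfl⟩

lemma IsGrayCode.isRectilinear {h : Fin n → Fin (Nat.clog 2 n) → ℝ} (H : IsGrayCode h) :
    IsRectilinear hn h := by
  intro i l l' hl hl'
  obtain ⟨hi, hi'⟩ := mem_Icc_of_step_ne_zero (step_apply_ne_zero hl)
  obtain ⟨i, rfl⟩ := Nat.exists_eq_add_of_le' hi
  have hlt : i + 1 < n := by omega
  have hstep : step hn h (i + 1) = h ⟨i + 1, hlt⟩ - h ⟨i, by omega⟩ :=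
    congrArg₂ _ (code_add_one ⟨i + 1, hlt⟩) (code_add_one ⟨i, by omega⟩)
  rw [hstep, Pi.sub_apply, sub_ne_zero] at hl hl'
  have abs_eq_one {l} (hne : h ⟨i + 1, hlt⟩ l ≠ h ⟨i, by omega⟩ l) :
      |h ⟨i, by omega⟩ l - h ⟨i + 1, hlt⟩ l| = 1 := by
    rcases H.1.1 ⟨i, by omega⟩ l with h₀ | h₀ <;> rcases H.1.1 ⟨i + 1, hlt⟩ l with h₁ | h₁ <;>
      simp_all
  by_contra hne
  have two_le := Finset.add_le_sum (f := fun l => |h ⟨i, by omega⟩ l - h ⟨i + 1, hlt⟩ l|)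
    (fun l _ => abs_nonneg _) (Finset.mem_univ l) (Finset.mem_univ l') hne
  rw [H.2 i hlt, abs_eq_one hl, abs_eq_one hl'] at two_le
  norm_num at two_le

section Description

/-- The coefficients of the lower bounds for `y`. -/
def lowerCode (hn : 0 < n) (h : Fin n → Fin k → ℝ) (l : Fin k) (j : Fin (n + 1)) : ℝ :=
  min (code hn h (j + 1) l) (code hn h j l)

/-- The coefficients of the upper bounds for `y`. -/
def upperCode (hn : 0 < n) (h : Fin n → Fin k → ℝ) (l : Fin k) (j : Fin (n + 1)) : ℝ :=
  max (code hn h (j + 1) l) (code hn h j l)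

lemma lowerCode_le_upperCode : lowerCode hn h ≤ upperCode hn h := fun _ _ => min_le_max

lemma gaps_lowerCode_upperCode : gaps (lowerCode hn h) (upperCode hn h) = flips hn h := by
  funext l
  ext j
  simp [gaps, flips, lowerCode, upperCode, step, sub_eq_zero]

lemma code_eq_of_mem_sos2 {i : Fin n} {lam : Fin (n + 1) → ℝ} (hlam : lam ∈ sos2 n i)
    {j : Fin (n + 1)} (hj : lam j ≠ 0) : code hn h (j + 1) = h i ∨ code hn h j = h i := by
  by_contra! hne
  refine hj ((hlam.2 j ?_ ?_).antisymm (hlam.1.1 j))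
  · rintro rfl
    exact hne.1 (code_add_one i)
  · rintro rfl
    exact hne.2 (code_add_one i)

lemma sos2_prod_subset_simplexBand (i : Fin n) :
    sos2 n i ×ˢ {h i} ⊆ simplexBand (lowerCode hn h) (upperCode hn h) := by
  rintro ⟨lam, _⟩ ⟨hlam : lam ∈ sos2 n i, rfl⟩
  have hsum (l) : ∑ j, h i l * lam j = h i l := by rw [← Finset.mul_sum, hlam.1.2, mul_one]
  have mem_Icc (l j) (hj : lam j ≠ 0) :
      h i l ∈ Set.Icc (lowerCode hn h l j) (upperCode hn h l j) := by
    rcases code_eq_of_mem_sos2 (hn := hn) (h := h) hlam hj with heq | heq <;>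
      simp [← heq, lowerCode, upperCode]
  refine ⟨hlam.1.2, fun l => ⟨?_, ?_⟩, hlam.1.1⟩
  · refine (Finset.sum_le_sum fun j _ => ?_).trans_eq (hsum l)
    rcases eq_or_ne (lam j) 0 with hj | hj
    · simp [hj]
    · exact mul_le_mul_of_nonneg_right (mem_Icc l j hj).1 (hlam.1.1 j)
  · refine (hsum l).symm.trans_le (Finset.sum_le_sum fun j _ => ?_)
    rcases eq_or_ne (lam j) 0 with hj | hj
    · simp [hj]
    · exact mul_le_mul_of_nonneg_right (mem_Icc l j hj).2 (hlam.1.1 j)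

lemma single_mem_embedding {i : Fin n} {j : Fin (n + 1)} (hj : j = i.castSucc ∨ j = i.succ) :
    (Pi.single j 1, h i) ∈ embedding (sos2 n) h := by
  refine subset_convexHull ℝ _ (Set.mem_iUnion.2 ⟨i, ⟨single_mem_stdSimplex ℝ j, ?_⟩, rfl⟩)
  intro j' hne hne'
  have : j' ≠ j := by rcases hj with rfl | rfl <;> assumption
  simp [this]

lemma single_code_mem_embedding (j : Fin (n + 1)) :
    (Pi.single j 1, code hn h (j + 1)) ∈ embedding (sos2 n) h ∧
      (Pi.single j 1, code hn h j) ∈ embedding (sos2 n) h := by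
  refine ⟨single_mem_embedding ?_, single_mem_embedding ?_⟩ <;>
    simp only [Fin.ext_iff, Fin.val_castSucc, Fin.val_succ] <;> omega

lemma mem_segment_of_mem_uIcc {L : Type*} {x y z : L → ℝ}
    (hne : ∀ l l', x l ≠ z l → x l' ≠ z l' → l = l') (hy : ∀ l, y l ∈ Set.uIcc (x l) (z l)) :
    y ∈ segment ℝ x z := by
  have eq_of_eq {l} (h : x l = z l) : y l = x l := by simpa [← h] using hy l
  by_cases hxz : x = z
  · obtain rfl : y = x := funext fun l => eq_of_eq (congrFun hxz l)
    exact left_mem_segment ℝ y z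
  obtain ⟨l, hl⟩ := Function.ne_iff.1 hxz
  have hyl := hy l
  rw [← segment_eq_uIcc, segment_eq_image'] at hyl
  obtain ⟨θ, hθ, hyθ⟩ := hyl
  rw [segment_eq_image']
  refine ⟨θ, hθ, funext fun l' => ?_⟩
  by_cases hl' : x l' = z l'
  · simp [eq_of_eq hl', hl']
  · exact hne l l' hl hl' ▸ hyθ

lemma IsRectilinear.embedding_eq_simplexBand (H : IsRectilinear hn h) :
    embedding (sos2 n) h = simplexBand (lowerCode hn h) (upperCode hn h) := by
  refine Set.Subset.antisymm (convexHull_min (Set.iUnion_subset sos2_prod_subset_simplexBand) ?_)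
    (simplexBand_subset lowerCode_le_upperCode (convex_convexHull ℝ _) fun j y hy => ?_)
  · rw [simplexBand_eq_coneSlice lowerCode_le_upperCode]
    exact convex_coneSlice
  · obtain ⟨hsucc, hcode⟩ := single_code_mem_embedding (hn := hn) (h := h) j
    refine (convex_convexHull ℝ _).segment_subset hsucc hcode ?_
    rw [← Prod.image_mk_segment_right]
    exact ⟨y, mem_segment_of_mem_uIcc (fun l l' hl hl' =>
      H j l l' (sub_ne_zero.2 hl) (sub_ne_zero.2 hl')) hy, rfl⟩

end Description

section Spans

/-- The coordinate subspace of `L → ℝ` spanned by the unit vectors with index in `A`. -/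
def coordSubspace {L : Type*} [Finite L] (A : Set L) : Submodule ℝ (L → ℝ) :=
  Submodule.span ℝ (Pi.basisFun ℝ L '' A)

section CoordSubspace

variable {L : Type*} [Finite L] {A B : Set L} {x : L → ℝ}

lemma mem_coordSubspace : x ∈ coordSubspace A ↔ ∀ l, x l ≠ 0 → l ∈ A := by
  rw [coordSubspace, Module.Basis.mem_span_image, Set.subset_def]
  simp

lemma coordSubspace_injective :
    Function.Injective (coordSubspace : Set L → Submodule ℝ (L → ℝ)) := by
  intro A B hAB
  ext l
  have self_mem (C : Set L) : Pi.basisFun ℝ L l ∈ coordSubspace C ↔ l ∈ C :=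
    (Pi.basisFun ℝ L).self_mem_span_image
  rw [← self_mem A, ← self_mem B, hAB]

lemma coordSubspace_univ : coordSubspace (Set.univ : Set L) = ⊤ := by
  rw [coordSubspace, Set.image_univ, Module.Basis.span_eq]

lemma coordSubspace_eq_top_iff : coordSubspace A = ⊤ ↔ A = Set.univ := by
  rw [← coordSubspace_univ, coordSubspace_injective.eq_iff]

lemma finrank_coordSubspace : Module.finrank ℝ (coordSubspace A) = A.ncard := by
  classical
  have := Fintype.ofFinite L
  rw [coordSubspace, Set.image_eq_range, Set.ncard_eq_toFinset_card', Set.toFinset_card]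
  exact finrank_span_eq_card ((Pi.basisFun ℝ L).linearIndependent.comp _ Subtype.val_injective)

end CoordSubspace

lemma IsRectilinear.step_eq_zero_of_ne (H : IsRectilinear hn h) {i : ℕ} {l l' : Fin k}
    (hl : step hn h i l ≠ 0) (hne : l' ≠ l) : step hn h i l' = 0 :=
  not_not.1 fun hl' => hne (H i l' l hl' hl)

lemma IsRectilinear.span_image_step (H : IsRectilinear hn h) (I : Set ℕ) :
    Submodule.span ℝ (step hn h '' I) = coordSubspace {l | ∃ i ∈ I, step hn h i l ≠ 0} := by
  refine le_antisymm (Submodule.span_le.2 ?_) (Submodule.span_le.2 ?_)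
  · rintro _ ⟨i, hi, rfl⟩
    exact mem_coordSubspace.2 fun l hl => ⟨i, hi, hl⟩
  · rintro _ ⟨l, ⟨i, hi, hl⟩, rfl⟩
    have eq_smul_step : Pi.basisFun ℝ (Fin k) l = (step hn h i l)⁻¹ • step hn h i := by
      ext l'
      rcases eq_or_ne l' l with rfl | hne
      · simp [hl]
      · simp [hne, H.step_eq_zero_of_ne hl hne]
    rw [eq_smul_step]
    exact Submodule.smul_mem _ _ (Submodule.subset_span ⟨i, hi, rfl⟩)

lemma IsRectilinear.encSpace_eq_top (H : IsRectilinear hn h)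
    (hflips : ∀ l, (flips hn h l).Nonempty) : encSpace h = ⊤ := by
  refine top_unique ?_
  have span_eq_top : Submodule.span ℝ (step hn h '' Set.univ) = ⊤ := by
    rw [H.span_image_step, coordSubspace_eq_top_iff, Set.eq_univ_iff_forall]
    exact fun l => ⟨_, trivial, (hflips l).some_mem⟩
  rw [← span_eq_top, Submodule.span_le]
  rintro _ ⟨i, -, rfl⟩
  exact vsub_mem_vectorSpan ℝ (Set.mem_range_self _) (Set.mem_range_self _)

lemma IsRectilinear.finrank_encSpace (H : IsRectilinear hn h)
    (hflips : ∀ l, (flips hn h l).Nonempty) : Module.finrank ℝ (encSpace h) = k := by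
  rw [H.encSpace_eq_top hflips, finrank_top, Module.finrank_fin_fun]

lemma IsRectilinear.spannedHyperplanes_eq_range (H : IsRectilinear hn h)
    (hflips : ∀ l, (flips hn h l).Nonempty) :
    spannedHyperplanes hn h = Set.range fun l => coordSubspace {l}ᶜ := by
  ext W
  simp only [spannedHyperplanes, H.finrank_encSpace hflips, H.encSpace_eq_top hflips,
    Set.mem_ofPred_eq, le_top, true_and, Set.mem_range]
  constructor
  · rintro ⟨hdim, I, -, rfl⟩
    rw [H.span_image_step] at hdim ⊢
    set A := {l | ∃ i ∈ I, step hn h i l ≠ 0}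
    have ncard_compl : Aᶜ.ncard = 1 := by
      have := Set.ncard_add_ncard_compl A
      rw [finrank_coordSubspace] at hdim
      rw [Nat.card_fin] at this
      omega
    obtain ⟨l, hl⟩ := Set.ncard_eq_one.1 ncard_compl
    exact ⟨l, by rw [← hl, compl_compl]⟩
  · rintro ⟨l, rfl⟩
    refine ⟨?_, {i | i ∈ Set.Icc 1 (n - 1) ∧ step hn h i l = 0}, fun i hi => hi.1, ?_⟩
    · have := Set.ncard_add_ncard_compl {l}
      rw [Set.ncard_singleton, Nat.card_fin] at this
      rw [finrank_coordSubspace]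
      omega
    · rw [H.span_image_step]
      congr 1
      ext l'
      refine ⟨fun hne => ?_, ?_⟩
      · obtain ⟨j, hj⟩ := hflips l'
        exact ⟨j, ⟨mem_Icc_of_step_ne_zero (step_apply_ne_zero hj),
          H.step_eq_zero_of_ne hj (Ne.symm hne)⟩, hj⟩
      · rintro ⟨i, ⟨-, hi⟩, hl'⟩ rfl
        exact hl' hi

lemma IsRectilinear.sizeG_eq (H : IsRectilinear hn h) (hflips : ∀ l, (flips hn h l).Nonempty) :
    sizeG hn h = 2 * k := by
  have coordHyperplane_injective : Function.Injective fun l : Fin k => coordSubspace {l}ᶜ :=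
    coordSubspace_injective.comp (compl_injective.comp Set.singleton_injective)
  rw [sizeG, H.spannedHyperplanes_eq_range hflips,
    Set.ncard_range_of_injective coordHyperplane_injective, Nat.card_fin]

lemma IsRectilinear.span_image_step_diff_eq_top_iff (H : IsRectilinear hn h)
    (hflips : ∀ l, (flips hn h l).Nonempty) (j : Fin (n + 1)) :
    Submodule.span ℝ (step hn h '' (Set.Icc 1 (n - 1) \ {(j : ℕ)})) = ⊤ ↔
      j ∉ soleElements (flips hn h) := by
  simp only [H.span_image_step, coordSubspace_eq_top_iff, Set.eq_univ_iff_forall, soleElements,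
    Set.mem_ofPred_eq, not_exists]
  refine forall_congr' fun l => ⟨?_, fun hne => ?_⟩
  · rintro ⟨i, ⟨-, hij⟩, hi⟩ hl
    obtain ⟨j', hj', rfl⟩ := exists_mem_flips_of_step_ne_zero hi
    exact hij (congrArg Fin.val (hl ▸ hj' : j' ∈ {j}))
  · obtain ⟨i, hi, hij⟩ : ∃ i ∈ flips hn h l, i ≠ j := by
      by_contra! heq
      exact hne (Set.eq_singleton_iff_nonempty_unique_mem.2 ⟨hflips l, heq⟩)
    exact ⟨i, ⟨mem_Icc_of_step_ne_zero (step_apply_ne_zero hi), Fin.val_ne_of_ne hij⟩, hi⟩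

lemma mem_Icc_of_mem_soleElements {j : Fin (n + 1)} (hj : j ∈ soleElements (flips hn h)) :
    (j : ℕ) ∈ Set.Icc 1 (n - 1) := by
  obtain ⟨l, hl⟩ := hj
  exact mem_Icc_of_step_ne_zero (step_apply_ne_zero (hl.ge rfl))

lemma IsRectilinear.boundIndices_eq_image (H : IsRectilinear hn h)
    (hflips : ∀ l, (flips hn h l).Nonempty) :
    boundIndices hn h = (fun j : Fin (n + 1) => (j : ℕ) + 1) '' (soleElements (flips hn h))ᶜ := by
  have add_one_mem_iff (j : Fin (n + 1)) :
      (j : ℕ) + 1 ∈ boundIndices hn h ↔ j ∉ soleElements (flips hn h) := by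
    have endpoint (hj : j ∈ soleElements (flips hn h)) := mem_Icc_of_mem_soleElements hj
    simp only [boundIndices, H.encSpace_eq_top hflips, eq_comm (a := (⊤ : Submodule ℝ _)),
      Set.mem_union, Set.mem_insert_iff, Set.mem_singleton_iff, Set.mem_ofPred_eq,
      add_tsub_cancel_right, H.span_image_step_diff_eq_top_iff hflips, Set.mem_Icc] at endpoint ⊢
    have := j.isLt
    by_cases hj : j ∈ soleElements (flips hn h)
    · have := endpoint hj
      simp only [hj, not_true_eq_false, and_false, or_false, iff_false]
      omega
    · simp only [hj, not_false_eq_true, and_true, iff_true]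
      omega
  ext m
  refine ⟨fun hm => ?_, ?_⟩
  · have hlt : m - 1 < n + 1 ∧ m - 1 + 1 = m := by
      rcases hm with (rfl | rfl) | ⟨⟨_, _⟩, _⟩ <;> omega
    exact ⟨⟨m - 1, hlt.1⟩, (add_one_mem_iff _).1 (hlt.2.symm ▸ hm), hlt.2⟩
  · rintro ⟨j, hj, rfl⟩
    exact (add_one_mem_iff j).2 hj

lemma IsRectilinear.sizeB_eq (H : IsRectilinear hn h) (hflips : ∀ l, (flips hn h l).Nonempty) :
    sizeB hn h = (soleElements (flips hn h))ᶜ.ncard := by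
  rw [sizeB, H.boundIndices_eq_image hflips]
  exact Set.ncard_image_of_injective _ fun i j hij => Fin.ext (Nat.succ_injective hij)

end Spans

section Counting

lemma code_eq_of_step_eq_zero {m m' : ℕ} (hle : m ≤ m') {l : Fin k}
    (hstep : ∀ i ∈ Set.Ico m m', step hn h i l = 0) : code hn h m l = code hn h m' l := by
  induction m', hle using Nat.le_induction with
  | base => rfl
  | succ i hmi ih =>
    have last_step := hstep i ⟨hmi, i.lt_succ_self⟩
    rw [ih fun j hj => hstep j ⟨hj.1, hj.2.trans i.lt_succ_self⟩]
    exact (sub_eq_zero.1 last_step).symm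

-- A codeword is determined by its bits outside `S` together with the number of positions of `T`
-- that have been passed.
lemma IsEncoding.le_card_add_one_mul_two_pow (H : IsEncoding h) {S : Finset (Fin k)}
    {T : Finset (Fin (n + 1))} (hST : ∀ l ∈ S, flips hn h l ⊆ T) :
    n ≤ (T.card + 1) * 2 ^ (k - S.card) := by
  classical
  let passed (m : Fin n) : Finset (Fin (n + 1)) := {j ∈ T | j ≤ m.castSucc}
  let label (m : Fin n) : Fin (T.card + 1) × (↥Sᶜ → Bool) :=
    (⟨(passed m).card, Nat.lt_succ_of_le (Finset.card_filter_le _ _)⟩, fun l => h m l = 1)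
  have eq_of_label_eq {m m' : Fin n} (hmm : m ≤ m') (heq : label m = label m') : m = m' := by
    refine H.2 (funext fun l => ?_)
    by_cases hl : l ∈ S
    · have passed_eq : passed m = passed m' := Finset.eq_of_subset_of_card_le
        (Finset.monotone_filter_right _ fun j _ hj => hj.trans hmm)
        (congrArg (fun p => (p.1 : ℕ)) heq).ge
      rw [← code_add_one (hn := hn) (h := h) m, ← code_add_one (hn := hn) (h := h) m']
      refine code_eq_of_step_eq_zero (by simpa using hmm) fun i hi => ?_
      by_contra hstep
      obtain ⟨j, hj, rfl⟩ := exists_mem_flips_of_step_ne_zero hstep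
      have hjm' : j ∈ passed m' := Finset.mem_filter.2 ⟨hST l hl hj, Nat.le_of_lt_succ hi.2⟩
      exact (Finset.mem_filter.1 (passed_eq ▸ hjm')).2.not_gt hi.1
    · have bit_eq : h m l = 1 ↔ h m' l = 1 := by
        simpa [label] using congrFun (congrArg Prod.snd heq) ⟨l, by simpa using hl⟩
      rcases H.1 m l with h₀ | h₀ <;> rcases H.1 m' l with h₁ | h₁ <;> simp_all
  have label_injective : Function.Injective label := fun m m' heq =>
    (le_total m m').elim (eq_of_label_eq · heq) fun hle => (eq_of_label_eq hle heq.symm).symm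
  simpa using Fintype.card_le_of_injective label label_injective

lemma IsEncoding.flips_nonempty (H : IsEncoding h) (hk : 2 ^ k < 2 * n) (l : Fin k) :
    (flips hn h l).Nonempty := by
  by_contra hempty
  have hcard := H.le_card_add_one_mul_two_pow (hn := hn) (S := {l}) (T := ∅)
    (by simp [Set.not_nonempty_iff_eq_empty.1 hempty])
  have hpow : 2 ^ k = 2 * 2 ^ (k - 1) := by rw [← pow_succ', Nat.sub_add_cancel l.pos]
  simp only [Finset.card_empty, Finset.card_singleton] at hcard
  omega

lemma two_mul_add_one_le_two_pow {s : ℕ} (hs : 3 ≤ s) : 2 * (s + 1) ≤ 2 ^ s := by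
  induction s, hs using Nat.le_induction with
  | base => norm_num
  | succ s hs ih =>
    rw [pow_succ]
    omega

lemma IsEncoding.ncard_soleElements_le_two (H : IsEncoding h) (hk : 2 ^ k < 2 * n) :
    (soleElements (flips hn h)).ncard ≤ 2 := by
  classical
  choose bit hbit using fun j : soleElements (flips hn h) => j.2
  have bit_injective : Function.Injective bit := fun i j hij =>
    Subtype.ext (Set.singleton_injective ((hbit i).symm.trans (hij ▸ hbit j)))
  set T := (soleElements (flips hn h)).toFinset with hT
  set S := Finset.univ.image bit
  have card_eq : S.card = T.card := by
    rw [Finset.card_image_of_injective _ bit_injective, hT, Set.toFinset_card, Finset.card_univ]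
  have card_le : T.card ≤ k := by simpa [card_eq] using Finset.card_le_univ S
  have hcard := H.le_card_add_one_mul_two_pow (hn := hn) (S := S) (T := T) fun l hl => by
    obtain ⟨j, -, rfl⟩ := Finset.mem_image.1 hl
    simp [hbit, hT]
  rw [card_eq] at hcard
  have two_pow_lt : 2 ^ T.card < 2 * (T.card + 1) := by
    refine lt_of_mul_lt_mul_right (a := 2 ^ (k - T.card)) ?_ (Nat.zero_le _)
    rw [← pow_add, Nat.add_sub_of_le card_le]
    linarith
  rw [Set.ncard_eq_toFinset_card', ← hT]
  by_contra! hlt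
  exact two_pow_lt.not_ge (two_mul_add_one_le_two_pow hlt)

end Counting

end Codes

section GrayCodes

lemma two_pow_clog_lt {n : ℕ} (hn : 0 < n) : 2 ^ Nat.clog 2 n < 2 * n := by
  obtain rfl | hlt : n = 1 ∨ 1 < n := by omega
  · simp
  · calc 2 ^ Nat.clog 2 n
        = 2 * 2 ^ (Nat.clog 2 n).pred := by
          rw [← pow_succ', ← Nat.succ_eq_add_one,
            Nat.succ_pred_eq_of_pos (Nat.clog_pos one_lt_two hlt)]
      _ < 2 * n := Nat.mul_lt_mul_of_pos_left (Nat.pow_pred_clog_lt_self one_lt_two hlt) two_pos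

variable {n : ℕ} {hn : 0 < n} {h : Fin n → Fin (Nat.clog 2 n) → ℝ}

lemma IsGrayCode.flips_nonempty (H : IsGrayCode h) (l : Fin (Nat.clog 2 n)) :
    (flips hn h l).Nonempty :=
  H.1.flips_nonempty (two_pow_clog_lt hn) l

lemma IsGrayCode.gaps_nonempty (H : IsGrayCode h) (l : Fin (Nat.clog 2 n)) :
    (gaps (lowerCode hn h) (upperCode hn h) l).Nonempty :=
  gaps_lowerCode_upperCode (hn := hn) (h := h) ▸ H.flips_nonempty l

lemma IsGrayCode.facetDefining_coord_iff (H : IsGrayCode h) {j : Fin (n + 1)} :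
    FacetDefining (embedding (sos2 n) h) (fun _ => 0) (fun p => p.1 j) ↔
      j ∉ soleElements (flips hn h) := by
  have : Nontrivial (Fin (n + 1)) := Fin.nontrivial_iff_two_le.2 (by omega)
  rw [(H.isRectilinear (hn := hn)).embedding_eq_simplexBand,
    EmbeddingForm.facetDefining_coord_iff lowerCode_le_upperCode H.gaps_nonempty,
    gaps_lowerCode_upperCode]

lemma IsGrayCode.sizeB_eq_ncard_facetDefining (H : IsGrayCode h) :
    sizeB hn h = {j : Fin (n + 1) |
      FacetDefining (embedding (sos2 n) h) (fun _ => 0) (fun p => p.1 j)}.ncard := by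
  rw [H.isRectilinear.sizeB_eq H.flips_nonempty]
  exact congrArg _ (Set.ext fun j => H.facetDefining_coord_iff.symm)

lemma IsGrayCode.polySize_embedding (H : IsGrayCode h) :
    polySize (embedding (sos2 n) h) = 2 * Nat.clog 2 n + sizeB hn h + 2 := by
  have : Nontrivial (Fin (n + 1)) := Fin.nontrivial_iff_two_le.2 (by omega)
  rw [(H.isRectilinear (hn := hn)).embedding_eq_simplexBand,
    polySize_simplexBand lowerCode_le_upperCode H.gaps_nonempty, gaps_lowerCode_upperCode,
    H.isRectilinear.sizeB_eq H.flips_nonempty, Fintype.card_fin]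

lemma IsGrayCode.sizeB_add_ncard (H : IsGrayCode h) :
    sizeB hn h + (soleElements (flips hn h)).ncard = n + 1 := by
  rw [H.isRectilinear.sizeB_eq H.flips_nonempty, add_comm, Set.ncard_add_ncard_compl, Nat.card_fin]

lemma IsGrayCode.sizeB_sub (H : IsGrayCode h) :
    (sizeB hn h : ℤ) - n = 1 - (soleElements (flips hn h)).ncard := by
  have := H.sizeB_add_ncard (hn := hn)
  omega

lemma IsGrayCode.polySize_sub (H : IsGrayCode h) :
    (polySize (embedding (sos2 n) h) : ℤ) - (2 * Nat.clog 2 n + n + 2) =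
      1 - (soleElements (flips hn h)).ncard := by
  rw [H.polySize_embedding (hn := hn), ← H.sizeB_sub]
  push_cast
  ring

end GrayCodes

section BoolCodes

variable {n k : ℕ}

/-- The real `0`-`1` vectors of a family of bit vectors. -/
def boolCode (v : Fin n → Fin k → Bool) (i : Fin n) (l : Fin k) : ℝ := if v i l then 1 else 0

lemma isGrayCode_boolCode {v : Fin n → Fin (Nat.clog 2 n) → Bool} (hv : Function.Injective v)
    (hdist : ∀ i j : Fin n, (j : ℕ) = i + 1 → hammingDist (v i) (v j) = 1) :
    IsGrayCode (boolCode v) := by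
  refine ⟨⟨fun i l => (ite_eq_or_eq _ _ _).symm, fun i j hij => hv (funext fun l => ?_)⟩,
    fun i hi => ?_⟩
  · have := congrFun hij l
    unfold boolCode at this
    split_ifs at this <;> simp_all
  · have abs_sub_eq (l) : |boolCode v ⟨i, by omega⟩ l - boolCode v ⟨i + 1, hi⟩ l| =
        if v ⟨i, by omega⟩ l ≠ v ⟨i + 1, hi⟩ l then 1 else 0 := by
      unfold boolCode
      cases v ⟨i, by omega⟩ l <;> cases v ⟨i + 1, hi⟩ l <;> simp
    simp only [abs_sub_eq, Finset.sum_boole]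
    exact_mod_cast hdist ⟨i, by omega⟩ ⟨i + 1, hi⟩ rfl

lemma mem_soleElements_flips_boolCode {hn : 0 < n} {v : Fin n → Fin k → Bool} {j : Fin (n + 1)} :
    j ∈ soleElements (flips hn (boolCode v)) ↔
      ∃ l, ∀ i : Fin (n + 1), code hn v (i + 1) l ≠ code hn v i l ↔ i = j := by
  have step_ne_zero (i : ℕ) (l : Fin k) :
      step hn (boolCode v) i l ≠ 0 ↔ code hn v (i + 1) l ≠ code hn v i l := by
    simp only [step, code, boolCode, Pi.sub_apply, sub_ne_zero]
    split_ifs <;> simp_all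
  simp only [soleElements, flips, Set.ext_iff, Set.mem_ofPred_eq, step_ne_zero,
    Set.mem_singleton_iff]

lemma exists_isGrayCode_ncard_soleElements_eq_zero :
    ∃ (n : ℕ) (hn : 0 < n) (h : Fin n → Fin (Nat.clog 2 n) → ℝ), 2 ≤ n ∧ IsGrayCode h ∧
      (soleElements (flips hn h)).ncard = 0 := by
  let v : Fin 8 → Fin (Nat.clog 2 8) → Bool := fun i l =>
    ((![1, 3, 2, 6, 7, 5, 4, 0] : Fin 8 → ℕ) i).testBit l
  have soleElements_eq : soleElements (flips (by norm_num) (boolCode v)) = ∅ := by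
    ext j
    rw [mem_soleElements_flips_boolCode]
    revert j
    decide
  exact ⟨8, by norm_num, boolCode v, by norm_num, isGrayCode_boolCode (by decide) (by decide),
    by rw [soleElements_eq, Set.ncard_empty]⟩

lemma exists_isGrayCode_ncard_soleElements_eq_two :
    ∃ (n : ℕ) (hn : 0 < n) (h : Fin n → Fin (Nat.clog 2 n) → ℝ), 2 ≤ n ∧ IsGrayCode h ∧
      (soleElements (flips hn h)).ncard = 2 := by
  let v : Fin 3 → Fin (Nat.clog 2 3) → Bool := fun i l => ((![0, 1, 3] : Fin 3 → ℕ) i).testBit l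
  have soleElements_eq : soleElements (flips (by norm_num) (boolCode v)) = {1, 2} := by
    ext j
    rw [mem_soleElements_flips_boolCode]
    revert j
    decide
  exact ⟨3, by norm_num, boolCode v, by norm_num, isGrayCode_boolCode (by decide) (by decide),
    by rw [soleElements_eq, Set.ncard_pair (by decide)]⟩

end BoolCodes

end EmbeddingForm

theorem corollary3 :
    (∀ (n : ℕ) (hn : 0 < n) (h : Fin n → Fin (Nat.clog 2 n) → ℝ), IsGrayCode h →
      -- the description of `Q(P, H)`; `j` is zero-based, so `h^j`, `h^{j-1}` of the usual numbering
      -- are `code hn h (j + 1)` and `code hn h j`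
      (∀ (lam : Fin (n + 1) → ℝ) (y : Fin (Nat.clog 2 n) → ℝ),
        (lam, y) ∈ embedding (sos2 n) h ↔
          ∑ j, lam j = 1 ∧
          (∀ l, ∑ j : Fin (n + 1), min (code hn h (j + 1) l) (code hn h j l) * lam j ≤ y l ∧
            y l ≤ ∑ j : Fin (n + 1), max (code hn h (j + 1) l) (code hn h j l) * lam j) ∧
          ∀ j, 0 ≤ lam j) ∧
      -- all general inequalities are facet defining
      (∀ l,
        FacetDefining (embedding (sos2 n) h)
          (fun p => ∑ j : Fin (n + 1), min (code hn h (j + 1) l) (code hn h j l) * p.1 j)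
          (fun p => p.2 l) ∧
        FacetDefining (embedding (sos2 n) h)
          (fun p => p.2 l)
          (fun p => ∑ j : Fin (n + 1), max (code hn h (j + 1) l) (code hn h j l) * p.1 j)) ∧
      sizeG hn h = 2 * Nat.clog 2 n ∧
      -- the facet defining variable bounds
      n - 1 ≤ {j : Fin (n + 1) |
        FacetDefining (embedding (sos2 n) h) (fun _ => 0) (fun p => p.1 j)}.ncard ∧
      sizeB hn h = {j : Fin (n + 1) |
        FacetDefining (embedding (sos2 n) h) (fun _ => 0) (fun p => p.1 j)}.ncard ∧
      -- the sizes
      polySize (embedding (sos2 n) h) =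
        sizeG hn h + sizeB hn h +
          2 * (1 + (Nat.clog 2 n - Module.finrank ℝ (encSpace h))) ∧
      |(sizeB hn h : ℤ) - n| ≤ 1 ∧
      |(polySize (embedding (sos2 n) h) : ℤ) - (2 * Nat.clog 2 n + n + 2)| ≤ 1) ∧
    -- both bounds are attained from above
    (∃ (n : ℕ) (hn : 0 < n) (h : Fin n → Fin (Nat.clog 2 n) → ℝ), 2 ≤ n ∧ IsGrayCode h ∧
      (sizeB hn h : ℤ) - n = 1 ∧
      (polySize (embedding (sos2 n) h) : ℤ) - (2 * Nat.clog 2 n + n + 2) = 1) ∧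
    -- both bounds are attained from below
    (∃ (n : ℕ) (hn : 0 < n) (h : Fin n → Fin (Nat.clog 2 n) → ℝ), 2 ≤ n ∧ IsGrayCode h ∧
      (sizeB hn h : ℤ) - n = -1 ∧
      (polySize (embedding (sos2 n) h) : ℤ) - (2 * Nat.clog 2 n + n + 2) = -1) := by
  refine ⟨fun n hn h H => ?_, ?_, ?_⟩
  · have : Nontrivial (Fin (n + 1)) := Fin.nontrivial_iff_two_le.2 (by omega)
    have sizeG_eq := H.isRectilinear.sizeG_eq (hn := hn) H.flips_nonempty
    have ncard_le_two := H.1.ncard_soleElements_le_two (hn := hn) (two_pow_clog_lt hn)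
    have sizeB_add := H.sizeB_add_ncard (hn := hn)
    have embedding_eq := (H.isRectilinear (hn := hn)).embedding_eq_simplexBand
    refine ⟨fun lam y => Set.ext_iff.1 embedding_eq (lam, y), fun l => ?_, sizeG_eq, ?_,
      H.sizeB_eq_ncard_facetDefining, ?_, ?_, ?_⟩
    · rw [embedding_eq]
      exact ⟨facetDefining_lower lowerCode_le_upperCode H.gaps_nonempty l,
        facetDefining_upper lowerCode_le_upperCode H.gaps_nonempty l⟩
    · rw [← H.sizeB_eq_ncard_facetDefining (hn := hn)]
      omega
    · rw [H.polySize_embedding (hn := hn), sizeG_eq, H.isRectilinear.finrank_encSpace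
        (hn := hn) H.flips_nonempty, Nat.sub_self]
    · rw [H.sizeB_sub, abs_le]
      omega
    · rw [H.polySize_sub (hn := hn), abs_le]
      omega
  · obtain ⟨n, hn, h, hn₂, H, hncard⟩ := exists_isGrayCode_ncard_soleElements_eq_zero
    exact ⟨n, hn, h, hn₂, H, by simp [H.sizeB_sub, hncard],
      by simp [H.polySize_sub (hn := hn), hncard]⟩
  · obtain ⟨n, hn, h, hn₂, H, hncard⟩ := exists_isGrayCode_ncard_soleElements_eq_two
    exact ⟨n, hn, h, hn₂, H, by simp [H.sizeB_sub, hncard],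
      by simp [H.polySize_sub (hn := hn), hncard]⟩
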